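/- Trail Trap is the following two-player game on a finite simple undirected graph $G$. Player 1 chooses a starting vertex and moves a token from it along an incident edge $e$ to the other endpoint. Player 2 then chooses any starting vertex and moves a second token from it along an incident edge $f\neq e$ to the other endpoint. Thereafter the players alternate turns, beginning with Player 1, each moving their own token from its current vertex to an adjacent vertex along an edge that has not been used before by either player (in either direction); vertices may be revisited and both tokens may occupy the same vertex. The first player who is unable to move on their turn loses. A graph $G$ is P1-win if Player 1 has a winning strategy in Trail Trap on $G$. Let $P_m$ denote the path graph on $m$ vertices and $\square$ the Cartesian product of graphs. If $n>3$ is odd, then the ladder grid $P_2\,\square\,P_n$ is P1-win. -/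

import Mathlib

namespace TrailTrap

variable {V : Type*} {G : SimpleGraph V}

/-- A partial game of Trail Trap on `G`: a list of moves in chronological order, the moves at
indices `0, 2, 4, …` being those of Player 1 and the moves at indices `1, 3, 5, …` those of
Player 2. A move `u → v` is a dart of `G`, that is, an ordered pair `(u, v)` of adjacent vertices.
Each edge of `G` is used at most once (by either player, in either direction), and after a player's
first move, each of their moves starts where their previous move ended. -/
def IsPartialGame (S : List G.Dart) : Prop :=
  (S.map SimpleGraph.Dart.edge).Nodup ∧
    ∀ (i : ℕ) (h : i + 2 < S.length), S[i].snd = S[i + 2].fst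

/-- The player whose turn it is after the partial game `S` can legally make the move `m`. -/
def IsLegalMove (S : List G.Dart) (m : G.Dart) : Prop :=
  IsPartialGame (S ++ [m])

/-- The game is over: the player whose turn it is has no legal move (and loses). -/
def IsOver (S : List G.Dart) : Prop :=
  ∀ m : G.Dart, ¬ IsLegalMove S m

/-- A strategy for Player 1 is a function `σ` that prescribes a next move from the list of all moves
made so far. The moves in `S` follow `σ` if each move of Player 1 is the one prescribed by `σ`. -/
def Follows (σ : List G.Dart → G.Dart) (S : List G.Dart) : Prop :=
  ∀ (i : ℕ) (h : i < S.length), Even i → S[i] = σ (S.take i)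

/-- The strategy `σ` is winning for Player 1: in every game in which Player 1 follows `σ`, the
strategy prescribes a legal move on each turn of Player 1 at which there is one, and whenever the
game is over, the last move was made by Player 1 (so Player 2 is the one who cannot move). -/
def IsWinningStrategy (σ : List G.Dart → G.Dart) : Prop :=
  ∀ S : List G.Dart, IsPartialGame S → Follows σ S →
    (Even S.length → ¬ IsOver S → IsLegalMove S (σ S)) ∧ (IsOver S → Odd S.length)

/-- The finite graph `G` is P1-win: Player 1 has a winning strategy in Trail Trap on `G`.
Finiteness guarantees that every game ends. -/
def P1Win {V : Type*} [Finite V] (G : SimpleGraph V) : Prop :=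
  ∃ σ : List G.Dart → G.Dart, IsWinningStrategy σ

end TrailTrap

/-!
Write `n = 2 * k + 1` with `k ≥ 2`, number the rows `0, 1` and the columns `-k, …, k`, and let
Player 1 open with the central rung, from `(0, 0)` to `(1, 0)`. The graph and the used edges are now
invariant under the reflection in the central column and under the half-turn. By the reflection,
assume that the first edge of Player 2 lies in the left half, and say that it leads to `v`.

* If `v` is `(1, -1)` or `(0, -1)`, then Player 1 moves to `(1, 1)`, the image of `v` under the
  reflection or the half-turn, and mirrors the play from then on (`Safe.of_mirror_columns`). The
  only edge whose mirror image may be taken is the edge `x` from `v` to column `0`. If Player 2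
  takes it at once, it is about to be stuck; if not, then two of the three edges at `v` are used,
  and Player 2 can never come back to `v` to take `x`.
* If `v = (0, 0)`, then after the move to `(1, 1)` both players run to the right, Player 1 one
  column ahead (`Safe.of_chase`). If `v = (1, 0)`, then the move to `(1, 1)` leaves Player 2 stuck.
* If `v = (0, -2)`, not reached from `(0, -1)`, then Player 1 moves to `(1, 1)` and runs to the
  right while Player 2 runs to the left along row `0` (`Safe.of_run`). When Player 2 steps down to
  row `1`, Player 1 moves to the column opposite. If Player 2 then continues to the left, mirroring
  wins (`Safe.of_turn`); if it turns back, then Player 1 turns back too, along row `0`, and is in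
  time to take the last edge at `(0, 0)` (`Safe.of_return`). If Player 2 begins by moving from
  `(0, -2)` to `(0, -1)`, then Player 1 answers along a short path to a mirror position
  (`Safe.of_inner`).
* In all other cases Player 2 is far enough away for Player 1 to move through `(1, -1)` and
  `(0, -1)` to `(0, 0)`, after which Player 2 is confined to the left half (`Safe.of_cut`). There
  are `2 * k` vertices there, each of which Player 2 can pass through only once, so walking around
  the untouched right half, which takes `2 * k + 1` moves, is enough (`Safe.of_around`).

Winning strategies are handled through `Safe` positions, those in which Player 1 can forever answer
the moves of Player 2. This is a greatest fixed point, so that invariants such as mirror symmetry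
prove safety by coinduction (`Safe.of_upto`), and no argument on the length of the game is needed.
-/

namespace TrailTrap

/-! ### Safe positions -/

section Safe

variable {W : Type*} {H : SimpleGraph W}

/-- A set `I` of positions with Player 2 to move is closed if Player 1 can answer every move of
Player 2 from a position in `I` so that the resulting position is in `I` again. A position is given
by the set `U` of used edges, the vertex `a` of Player 1 and the vertex `b` of Player 2. -/
def IsClosedFamily (H : SimpleGraph W) (I : Set (Sym2 W) → W → W → Prop) : Prop :=
  ∀ U a b, I U a b → ∀ q, H.Adj b q → s(b, q) ∉ U →
    ∃ a', H.Adj a a' ∧ s(a, a') ∉ insert s(b, q) U ∧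
      I (insert s(a, a') (insert s(b, q) U)) a' q

/-- A position with Player 2 to move is safe if Player 1 can forever answer the moves of Player 2.
On a finite graph this means that Player 1 wins. It is defined as the largest closed family. -/
def Safe (H : SimpleGraph W) (U : Set (Sym2 W)) (a b : W) : Prop :=
  ∃ I, IsClosedFamily H I ∧ I U a b

theorem Safe.reply {U : Set (Sym2 W)} {a b : W} (h : Safe H U a b) {q : W} (hq : H.Adj b q)
    (hU : s(b, q) ∉ U) :
    ∃ a', H.Adj a a' ∧ s(a, a') ∉ insert s(b, q) U ∧
      Safe H (insert s(a, a') (insert s(b, q) U)) a' q := by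
  obtain ⟨I, hI, h⟩ := h
  obtain ⟨a', h1, h2, h3⟩ := hI U a b h q hq hU
  exact ⟨a', h1, h2, I, hI, h3⟩

/-- Coinduction: a position is safe if it lies in a family of positions in which Player 1 can answer
each move so as to stay in the family or to reach a safe position. -/
theorem Safe.of_upto (I : Set (Sym2 W) → W → W → Prop)
    (hI : ∀ U a b, I U a b → ∀ q, H.Adj b q → s(b, q) ∉ U →
      ∃ a', H.Adj a a' ∧ s(a, a') ∉ insert s(b, q) U ∧
        (I (insert s(a, a') (insert s(b, q) U)) a' q ∨
          Safe H (insert s(a, a') (insert s(b, q) U)) a' q))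
    {U : Set (Sym2 W)} {a b : W} (h : I U a b) : Safe H U a b := by
  refine ⟨fun U a b => I U a b ∨ Safe H U a b, ?_, Or.inl h⟩
  rintro U a b (h | h) q hq hU
  · exact hI U a b h q hq hU
  · obtain ⟨c, h1, h2, h3⟩ := h.reply hq hU
    exact ⟨c, h1, h2, Or.inr h3⟩

theorem Safe.of_reply {U : Set (Sym2 W)} {a b : W}
    (h : ∀ q, H.Adj b q → s(b, q) ∉ U → ∃ a', H.Adj a a' ∧ s(a, a') ∉ insert s(b, q) U ∧
      Safe H (insert s(a, a') (insert s(b, q) U)) a' q) : Safe H U a b := by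
  refine .of_upto (fun U' a' b' => U' = U ∧ a' = a ∧ b' = b) ?_ ⟨rfl, rfl, rfl⟩
  rintro _ _ _ ⟨rfl, rfl, rfl⟩ q hq hU
  obtain ⟨c, h1, h2, h3⟩ := h q hq hU
  exact ⟨c, h1, h2, Or.inr h3⟩

theorem Safe.of_stuck {U : Set (Sym2 W)} {a b : W} (h : ∀ q, H.Adj b q → s(b, q) ∈ U) :
    Safe H U a b :=
  .of_reply fun q hq hU => absurd (h q hq) hU

/-- Safety is preserved by automorphisms of the graph. -/
theorem Safe.map (φ : H ≃g H) {U : Set (Sym2 W)} {a b : W} (h : Safe H U a b) :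
    Safe H (Sym2.map φ '' U) (φ a) (φ b) := by
  refine ⟨fun U' a' b' => ∃ U a b, Safe H U a b ∧ U' = Sym2.map φ '' U ∧ a' = φ a ∧ b' = φ b,
    ?_, U, a, b, h, rfl, rfl, rfl⟩
  rintro _ _ _ ⟨U, a, b, h, rfl, rfl, rfl⟩ q hq hU
  have inj : Function.Injective (Sym2.map φ) := Sym2.map.injective φ.injective
  obtain ⟨q, rfl⟩ := φ.surjective q
  rw [← Sym2.map_mk, inj.mem_set_image] at hU
  obtain ⟨a', h1, h2, h3⟩ := h.reply (φ.map_adj_iff.1 hq) hU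
  refine ⟨φ a', φ.map_adj_iff.2 h1, ?_, _, a', q, h3, ?_, rfl, rfl⟩
  · rwa [← Sym2.map_mk, ← Sym2.map_mk, ← Set.image_insert_eq, inj.mem_set_image]
  · simp only [Set.image_insert_eq, Sym2.map_mk]

end Safe

/-! ### Safe positions give winning strategies -/

section Strategy

variable {V W : Type*} {G : SimpleGraph V} {H : SimpleGraph W}

theorem IsPartialGame.of_append {S T : List G.Dart} (h : IsPartialGame (S ++ T)) :
    IsPartialGame S := by
  refine ⟨?_, fun i hi => ?_⟩
  · have := h.1
    rw [List.map_append] at this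
    exact this.of_append_left
  · have := h.2 i (by simp; omega)
    rwa [List.getElem_append_left (by omega), List.getElem_append_left hi] at this

theorem isPartialGame_append_singleton {S : List G.Dart} {m : G.Dart} :
    IsPartialGame (S ++ [m]) ↔ IsPartialGame S ∧ m.edge ∉ S.map SimpleGraph.Dart.edge ∧
      ∀ (i : ℕ) (h : i + 2 = S.length), (S[i]'(by omega)).snd = m.fst := by
  constructor
  · intro h
    refine ⟨h.of_append, ?_, fun i hi => ?_⟩
    · have := h.1
      rw [List.map_append, List.nodup_append] at this
      intro hm
      exact this.2.2 _ hm m.edge (by simp) rfl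
    · have := h.2 i (by simp; omega)
      rw [List.getElem_append_left (by omega), List.getElem_append_right (by omega)] at this
      simpa using this
  · rintro ⟨h, h1, h2⟩
    refine ⟨?_, fun i hi => ?_⟩
    · rw [List.map_append, List.nodup_append]
      refine ⟨h.1, by simp, ?_⟩
      rintro x hx y hy rfl
      simp only [List.map_cons, List.map_nil, List.mem_singleton] at hy
      exact h1 (hy ▸ hx)
    · simp only [List.length_append, List.length_singleton] at hi
      rcases Nat.lt_or_ge (i + 2) S.length with h' | h'
      · rw [List.getElem_append_left (by omega), List.getElem_append_left h']
        exact h.2 i h'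
      · rw [List.getElem_append_left (by omega), List.getElem_append_right (by omega)]
        simpa using h2 i (by omega)

theorem isPartialGame_append_pair_singleton {S : List G.Dart} {x y m : G.Dart} :
    IsPartialGame (S ++ [x, y] ++ [m]) ↔ IsPartialGame (S ++ [x, y]) ∧
      m.edge ∉ (S ++ [x, y]).map SimpleGraph.Dart.edge ∧ x.snd = m.fst := by
  rw [isPartialGame_append_singleton]
  refine and_congr_right fun _ => and_congr_right fun _ => ⟨fun h => ?_, fun h i hi => ?_⟩
  · simpa using h S.length (by simp)
  · obtain rfl : i = S.length := by simpa using hi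
    simpa using h

/-- If Player 1 can keep to a set of partial games that contains a legal answer to each legal move
of Player 2 made in it, then Player 1 has a winning strategy. -/
theorem exists_isWinningStrategy (good : List G.Dart → Prop) (m₀ : G.Dart)
    (h₀ : good [m₀])
    (hgood : ∀ S f, Odd S.length → good S → IsPartialGame (S ++ [f]) →
      ∃ m, IsLegalMove (S ++ [f]) m ∧ good (S ++ [f] ++ [m])) :
    ∃ σ : List G.Dart → G.Dart, IsWinningStrategy σ := by
  classical
  let σ : List G.Dart → G.Dart := fun S =>
    if h : ∃ m, IsLegalMove S m ∧ good (S ++ [m]) then h.choose else m₀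
  have hσ : ∀ S, (∃ m, IsLegalMove S m ∧ good (S ++ [m])) →
      IsLegalMove S (σ S) ∧ good (S ++ [σ S]) := by
    intro S h
    simp only [σ, dif_pos h]
    exact h.choose_spec
  have key : ∀ S : List G.Dart, IsPartialGame S → Follows σ S →
      (Odd S.length → good S) ∧
      (Even S.length → ∃ m, IsLegalMove S m ∧ good (S ++ [m])) := by
    intro S
    induction S using List.reverseRecOn with
    | nil =>
      intro _ _
      refine ⟨fun h => by simp at h, fun _ => ⟨m₀, ?_, h₀⟩⟩
      rw [IsLegalMove, isPartialGame_append_singleton]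
      refine ⟨⟨by simp, fun i hi => by simp at hi⟩, by simp, fun i hi => by simp at hi⟩
    | append_singleton S f ih =>
      intro hS hF
      have hF' : Follows σ S := by
        intro i hi he
        have := hF i (by simp; omega) he
        rwa [List.getElem_append_left hi, List.take_append_of_le_length hi.le] at this
      obtain ⟨ih1, ih2⟩ := ih hS.of_append hF'
      simp only [List.length_append, List.length_singleton]
      refine ⟨fun h => ?_, fun h => ?_⟩
      · have he : Even S.length := by grind
        have := hF S.length (by simp) he
        simp only [List.getElem_concat_length, List.take_left'] at this
        rw [this]
        exact (hσ S (ih2 he)).2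
      · have ho : Odd S.length := by grind
        exact hgood S f ho (ih1 ho) hS
  refine ⟨σ, fun S hS hF => ⟨fun he _ => (hσ S ((key S hS hF).2 he)).1, fun hover => ?_⟩⟩
  by_contra hodd
  obtain ⟨m, hm, -⟩ := (key S hS hF).2 (Nat.not_odd_iff_even.1 hodd)
  exact hover m hm

/-- Player 1 wins on `G` if, in a graph `H` that consists of a copy of `G` and isolated vertices,
Player 1 has a first move such that each first move of Player 2 has an answer leading to a safe
position. -/
theorem p1Win_of_safe [Finite V] (φ : G ↪g H)
    (hφ : ∀ p q, H.Adj p q → p ∈ Set.range φ) {a₀ a : W} (ha : H.Adj a₀ a)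
    (h : ∀ b₀ b, H.Adj b₀ b → s(b₀, b) ≠ s(a₀, a) →
      ∃ a', H.Adj a a' ∧ s(a, a') ∉ ({s(b₀, b), s(a₀, a)} : Set (Sym2 W)) ∧
        Safe H {s(a, a'), s(b₀, b), s(a₀, a)} a' b) : P1Win G := by
  have lift : ∀ x : V, ∀ q : W, H.Adj (φ x) q → ∃ m : G.Dart, m.fst = x ∧ φ m.snd = q := by
    intro x q hq
    obtain ⟨y, rfl⟩ := hφ _ _ hq.symm
    exact ⟨⟨(x, y), φ.map_adj_iff.1 hq⟩, rfl, rfl⟩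
  have inj : Function.Injective (Sym2.map φ) := Sym2.map.injective φ.injective
  -- the image in `H` of the edges used in a partial game
  let used : List G.Dart → Set (Sym2 W) := fun S => {e | e ∈ S.map fun d => s(φ d.fst, φ d.snd)}
  have mem_used : ∀ (S : List G.Dart) (m : G.Dart),
      s(φ m.fst, φ m.snd) ∈ used S ↔ m.edge ∈ S.map SimpleGraph.Dart.edge := by
    intro S m
    have hmap : ∀ d : G.Dart, s(φ d.fst, φ d.snd) = Sym2.map φ d.edge := fun d => rfl
    simp only [used, Set.mem_ofPred_eq, List.mem_map, hmap, inj.eq_iff]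
  have used_append : ∀ (S : List G.Dart) (m : G.Dart),
      used (S ++ [m]) = insert s(φ m.fst, φ m.snd) (used S) := by
    intro S m
    ext e
    simp only [used, List.map_append, List.map_cons, List.map_nil, List.mem_append,
      List.mem_singleton, Set.mem_ofPred_eq, Set.mem_insert_iff]
    exact or_comm
  obtain ⟨x₀, rfl⟩ := hφ _ _ ha
  obtain ⟨m₀, rfl, rfl⟩ := lift _ _ ha
  refine exists_isWinningStrategy (fun S => S = [m₀] ∨ ∃ T x y, S = T ++ [x, y] ∧
    Safe H (used S) (φ y.snd) (φ x.snd)) m₀ (Or.inl rfl) ?_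
  rintro S f - (rfl | ⟨T, x, y, rfl, hsafe⟩) hf
  · have hne : s(φ f.fst, φ f.snd) ≠ s(φ m₀.fst, φ m₀.snd) := by
      have h' := (isPartialGame_append_singleton.1 hf).2.1
      rw [← mem_used] at h'
      simpa [used] using h'
    obtain ⟨a', h1, h2, h3⟩ := h _ _ (φ.map_adj_iff.2 f.adj) hne
    obtain ⟨m, hm, rfl⟩ := lift _ _ h1
    rw [← hm] at h2 h3
    have hu : used [m₀, f] = {s(φ f.fst, φ f.snd), s(φ m₀.fst, φ m₀.snd)} := by
      ext e
      simp only [used, List.map_cons, List.map_nil, List.mem_cons, List.not_mem_nil, or_false,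
        Set.mem_ofPred_eq, Set.mem_insert_iff, Set.mem_singleton_iff]
      exact or_comm
    rw [← hm] at hu
    refine ⟨m, ?_, Or.inr ⟨[m₀], f, m, rfl, ?_⟩⟩
    · have := isPartialGame_append_pair_singleton (S := []) (x := m₀) (y := f) (m := m)
      refine this.2 ⟨hf, ?_, hm.symm⟩
      rwa [List.nil_append, ← mem_used, hu]
    · rw [used_append]
      exact hu ▸ h3
  · obtain ⟨hS, hf1, hf2⟩ := isPartialGame_append_pair_singleton.1 hf
    rw [← mem_used] at hf1
    rw [hf2] at hsafe
    obtain ⟨a', h1, h2, h3⟩ := hsafe.reply (φ.map_adj_iff.2 f.adj) hf1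
    obtain ⟨m, hm, rfl⟩ := lift _ _ h1
    have e1 : T ++ [x, y] ++ [f] = (T ++ [x]) ++ [y, f] := by simp
    rw [← hm, ← used_append] at h2 h3
    refine ⟨m, ?_, Or.inr ⟨T ++ [x, y], f, m, by simp, ?_⟩⟩
    · rw [IsLegalMove, e1, isPartialGame_append_pair_singleton, ← e1, ← mem_used]
      exact ⟨hf, h2, hm.symm⟩
    · rw [used_append]
      exact h3

end Strategy

/-! ### The ladder in centred coordinates -/

/-- The ladder with `2 * k + 1` columns, on the vertices `(r, c)` with row `r ∈ {0, 1}` and column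
`-k ≤ c ≤ k`. All other points of `ℤ × ℤ` are isolated. -/
def ladder (k : ℤ) : SimpleGraph (ℤ × ℤ) where
  Adj p q := (0 ≤ p.1 ∧ p.1 ≤ 1 ∧ 0 ≤ q.1 ∧ q.1 ≤ 1) ∧
    (-k ≤ p.2 ∧ p.2 ≤ k ∧ -k ≤ q.2 ∧ q.2 ≤ k) ∧
    (p.1 = q.1 ∧ (q.2 = p.2 + 1 ∨ p.2 = q.2 + 1) ∨ p.1 ≠ q.1 ∧ p.2 = q.2)
  symm := ⟨fun p q h => by omega⟩
  loopless := ⟨fun p h => by omega⟩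

theorem ladder_adj {k r c r' c' : ℤ} : (ladder k).Adj (r, c) (r', c') ↔
    (0 ≤ r ∧ r ≤ 1 ∧ 0 ≤ r' ∧ r' ≤ 1) ∧ (-k ≤ c ∧ c ≤ k ∧ -k ≤ c' ∧ c' ≤ k) ∧
    (r = r' ∧ (c' = c + 1 ∨ c = c' + 1) ∨ r ≠ r' ∧ c = c') := Iff.rfl

/-- The reflection of the ladder in its central column. -/
def reflection (k : ℤ) : ladder k ≃g ladder k where
  toFun p := (p.1, -p.2)
  invFun p := (p.1, -p.2)
  left_inv p := by simp
  right_inv p := by simp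
  map_rel_iff' := by
    rintro ⟨r, c⟩ ⟨r', c'⟩
    simp only [Equiv.coe_fn_mk, ladder_adj]
    omega

/-- The rotation of the ladder by a half-turn. -/
def rotation (k : ℤ) : ladder k ≃g ladder k where
  toFun p := (1 - p.1, -p.2)
  invFun p := (1 - p.1, -p.2)
  left_inv p := by simp
  right_inv p := by simp
  map_rel_iff' := by
    rintro ⟨r, c⟩ ⟨r', c'⟩
    simp only [Equiv.coe_fn_mk, ladder_adj]
    omega

theorem reflection_apply (k r c : ℤ) : reflection k (r, c) = (r, -c) := rfl

theorem rotation_apply (k r c : ℤ) : rotation k (r, c) = (1 - r, -c) := rfl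

variable {k : ℤ}

theorem eq_of_ladder_adj {r c : ℤ} {q : ℤ × ℤ} (h : (ladder k).Adj (r, c) q) :
    q = (r, c + 1) ∨ q = (r, c - 1) ∨ q = (1 - r, c) := by
  obtain ⟨r', c'⟩ := q
  simp only [ladder_adj, Prod.mk.injEq] at *
  omega

/-- The edge between the columns `c` and `c + 1` in row `r`. -/
@[irreducible] def rail (r c : ℤ) : Sym2 (ℤ × ℤ) := s((r, c), (r, c + 1))

/-- The edge between the two rows in column `c`. -/
@[irreducible] def rung (c : ℤ) : Sym2 (ℤ × ℤ) := s((0, c), (1, c))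

theorem rail_inj {r c r' c' : ℤ} : rail r c = rail r' c' ↔ r = r' ∧ c = c' := by
  simp only [rail, Sym2.eq_iff, Prod.mk.injEq]
  omega

theorem rung_inj {c c' : ℤ} : rung c = rung c' ↔ c = c' := by
  simp [rung]

theorem rail_ne_rung {r c c' : ℤ} : rail r c ≠ rung c' := by
  simp only [rail, rung, ne_eq, Sym2.eq_iff, Prod.mk.injEq]
  omega

theorem rung_ne_rail {r c c' : ℤ} : rung c' ≠ rail r c := rail_ne_rung.symm

theorem mk_right (r c : ℤ) : s((r, c), (r, c + 1)) = rail r c := by rw [rail]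

theorem mk_left (r c : ℤ) : s((r, c), (r, c - 1)) = rail r (c - 1) := by
  rw [rail, Sym2.eq_swap, sub_add_cancel]

theorem mk_rung {r r' c : ℤ} (h : (ladder k).Adj (r, c) (r', c)) : s((r, c), (r', c)) = rung c := by
  rw [ladder_adj] at h
  obtain ⟨rfl, rfl⟩ | ⟨rfl, rfl⟩ : r = 0 ∧ r' = 1 ∨ r = 1 ∧ r' = 0 := by omega
  · rw [rung]
  · rw [rung, Sym2.eq_swap]

/-- The possible moves from a vertex. -/
theorem ladder_adj_cases {r c : ℤ} {q : ℤ × ℤ} (h : (ladder k).Adj (r, c) q) :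
    (q = (r, c + 1) ∧ c < k ∧ s((r, c), q) = rail r c) ∨
    (q = (r, c - 1) ∧ -k < c ∧ s((r, c), q) = rail r (c - 1)) ∨
    (q = (1 - r, c) ∧ s((r, c), q) = rung c) := by
  have h' := h
  rcases eq_of_ladder_adj h with rfl | rfl | rfl <;> rw [ladder_adj] at h'
  · exact Or.inl ⟨rfl, by omega, mk_right r c⟩
  · exact Or.inr (Or.inl ⟨rfl, by omega, mk_left r c⟩)
  · exact Or.inr (Or.inr ⟨rfl, mk_rung h⟩)

/-! ### Moves on the ladder -/

/-- Player 1 at `a` has a move that leads to a safe position, Player 2 being at `b`. -/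
def CanReply (k : ℤ) (U : Set (Sym2 (ℤ × ℤ))) (a b : ℤ × ℤ) : Prop :=
  ∃ a', (ladder k).Adj a a' ∧ s(a, a') ∉ U ∧ Safe (ladder k) (insert s(a, a') U) a' b

section Moves

variable {U : Set (Sym2 (ℤ × ℤ))} {a b : ℤ × ℤ} {r c : ℤ}

theorem CanReply.right (hr : 0 ≤ r ∧ r ≤ 1) (hc : -k ≤ c) (hck : c < k) (hU : rail r c ∉ U)
    (h : Safe (ladder k) (insert (rail r c) U) (r, c + 1) b) : CanReply k U (r, c) b := by
  refine ⟨(r, c + 1), ?_, ?_, ?_⟩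
  · rw [ladder_adj]
    omega
  · rwa [mk_right]
  · rwa [mk_right]

theorem CanReply.left (hr : 0 ≤ r ∧ r ≤ 1) (hc : -k < c) (hck : c ≤ k) (hU : rail r (c - 1) ∉ U)
    (h : Safe (ladder k) (insert (rail r (c - 1)) U) (r, c - 1) b) : CanReply k U (r, c) b := by
  refine ⟨(r, c - 1), ?_, ?_, ?_⟩
  · rw [ladder_adj]
    omega
  · rwa [mk_left]
  · rwa [mk_left]

theorem CanReply.cross (hr : 0 ≤ r ∧ r ≤ 1) (hc : -k ≤ c) (hck : c ≤ k) (hU : rung c ∉ U)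
    (h : Safe (ladder k) (insert (rung c) U) (1 - r, c) b) : CanReply k U (r, c) b := by
  have hadj : (ladder k).Adj (r, c) (1 - r, c) := by
    rw [ladder_adj]
    omega
  refine ⟨(1 - r, c), hadj, ?_, ?_⟩
  · rwa [mk_rung hadj]
  · rwa [mk_rung hadj]

theorem Safe.of_moves
    (hright : c < k → rail r c ∉ U → CanReply k (insert (rail r c) U) a (r, c + 1))
    (hleft : -k < c → rail r (c - 1) ∉ U → CanReply k (insert (rail r (c - 1)) U) a (r, c - 1))
    (hrung : rung c ∉ U → CanReply k (insert (rung c) U) a (1 - r, c)) :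
    Safe (ladder k) U a (r, c) := by
  refine .of_reply fun q hq hU => ?_
  rcases ladder_adj_cases hq with ⟨rfl, h1, h2⟩ | ⟨rfl, h1, h2⟩ | ⟨rfl, h2⟩ <;> rw [h2] at hU ⊢
  · exact hright h1 hU
  · exact hleft h1 hU
  · exact hrung hU

theorem Safe.of_used (hright : c < k → rail r c ∈ U) (hleft : -k < c → rail r (c - 1) ∈ U)
    (hrung : rung c ∈ U) : Safe (ladder k) U a (r, c) :=
  .of_moves (fun h1 h2 => absurd (hright h1) h2) (fun h1 h2 => absurd (hleft h1) h2)
    fun h2 => absurd hrung h2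

end Moves

/-! ### Mirroring -/

/-- Player 1 mirrors the moves of Player 2, under a symmetry `τ` that exchanges the two sides of
the ladder. The token of Player 2 stays in the set `C`, on the left, until it makes its last move.
The mirror image of each edge that Player 2 can use has to be unused. -/
theorem Safe.of_mirror (τ : ladder k ≃g ladder k) (hτ : ∀ p, (τ p).2 = -p.2) {C : Set (ℤ × ℤ)}
    (hC : ∀ p ∈ C, p.2 < 0) {U : Set (Sym2 (ℤ × ℤ))} {b : ℤ × ℤ} (hb : b ∈ C)
    (h : ∀ p ∈ C, ∀ q, (ladder k).Adj p q → s(p, q) ∉ U → s(τ p, τ q) ∉ U ∧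
      (q ∈ C ∨ ∀ z, (ladder k).Adj q z → z ≠ p → s(q, z) ∈ U ∨ s(q, z) = s(τ p, τ q))) :
    Safe (ladder k) U (τ b) b := by
  refine .of_upto (fun U a b => a = τ b ∧ b ∈ C ∧ ∀ p ∈ C, ∀ q, (ladder k).Adj p q →
      s(p, q) ∉ U → s(τ p, τ q) ∉ U ∧ (q ∈ C ∨ ∀ z, (ladder k).Adj q z → z ≠ p →
      s(q, z) ∈ U ∨ s(q, z) = s(τ p, τ q))) ?_ ⟨rfl, hb, h⟩
  rintro U _ p ⟨rfl, hp, h⟩ q hpq hU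
  -- an edge with an endpoint on the left is not the mirror image of such an edge
  have hne : ∀ p' ∈ C, ∀ q', s(τ p', τ q') ≠ s(p, q) := by
    intro p' hp' q' heq
    have h1 := hC p hp
    have h2 := hC p' hp'
    have h3 := hτ p'
    obtain ⟨-, -, h4⟩ := hpq
    rcases Sym2.eq_iff.1 heq with ⟨h5, h6⟩ | ⟨h5, h6⟩
    · rw [h5] at h3
      omega
    · rw [h5] at h3
      omega
  obtain ⟨h1, h2⟩ := h p hp q hpq hU
  refine ⟨τ q, τ.map_adj_iff.2 hpq, ?_, ?_⟩
  · rw [Set.mem_insert_iff, not_or]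
    exact ⟨hne p hp q, h1⟩
  rcases h2 with h2 | h2
  · refine Or.inl ⟨rfl, h2, fun p' hp' q' hpq' hU' => ?_⟩
    simp only [Set.mem_insert_iff, not_or] at hU'
    obtain ⟨h3, h4⟩ := h p' hp' q' hpq' hU'.2.2
    refine ⟨?_, h4.imp_right fun h4 z hz hzp => (h4 z hz hzp).imp_left fun h5 =>
      Or.inr (Or.inr h5)⟩
    simp only [Set.mem_insert_iff, not_or]
    refine ⟨fun heq => hU'.2.1 ?_, hne p' hp' q', h3⟩
    exact Sym2.map.injective τ.injective heq
  · refine Or.inr (.of_stuck fun z hz => ?_)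
    by_cases hzp : z = p
    · rw [hzp]
      exact Or.inr (Or.inl Sym2.eq_swap)
    · exact (h2 z hz hzp).elim (fun h => Or.inr (Or.inr h)) Or.inl

/-- Player 1 mirrors the moves of Player 2, whose token is to the left of column `-j`. Here `w` is a
vertex that Player 2 cannot enter from there (any vertex on the right will do if none is needed),
and once Player 2 enters column `-j`, it is stuck. -/
theorem Safe.of_mirror_columns {τ : ladder k ≃g ladder k} {ρ : ℤ → ℤ}
    (hτ : ∀ r c, τ (r, c) = (ρ r, -c)) {j : ℤ} (hj : 0 ≤ j) (w : ℤ × ℤ)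
    {U : Set (Sym2 (ℤ × ℤ))} {a : ℤ × ℤ} {r₀ c₀ : ℤ} (ha : a = (ρ r₀, -c₀)) (hc₀ : c₀ < -j)
    (hw₀ : (r₀, c₀) ≠ w) (hw : ∀ p, p.2 < -j → (ladder k).Adj p w → s(p, w) ∈ U)
    (hrail : ∀ r c, 0 ≤ r ∧ r ≤ 1 → -k ≤ c → c < -j → (r, c) ≠ w → rail r c ∉ U →
      rail (ρ r) (-c - 1) ∉ U)
    (hrung : ∀ c, -k ≤ c → c < -j → rung c ∉ U → rung (-c) ∉ U)
    (hexit : ∀ r, 0 ≤ r ∧ r ≤ 1 → (r, -j - 1) ≠ w → rail r (-j - 1) ∉ U →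
      rung (-j) ∈ U ∧ (rail r (-j) ∈ U ∨ rail r (-j) = rail (ρ r) j)) :
    Safe (ladder k) U a (r₀, c₀) := by
  rw [ha, ← hτ]
  refine .of_mirror τ (fun p => by rw [hτ p.1 p.2]) (C := {p | p.2 < -j ∧ p ≠ w}) ?_ ⟨hc₀, hw₀⟩ ?_
  · rintro p ⟨hp, -⟩
    omega
  rintro ⟨r, c⟩ ⟨hc, hpw⟩ q hpq hU
  have hqw : q ≠ w := by
    rintro rfl
    exact hU (hw _ hc hpq)
  have hτadj := τ.map_adj_iff.2 hpq
  have hpq' := hpq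
  rcases ladder_adj_cases hpq with ⟨rfl, h1, h2⟩ | ⟨rfl, h1, h2⟩ | ⟨rfl, h2⟩ <;>
    rw [h2] at hU <;> rw [ladder_adj] at hpq' <;> simp only at hc
  · have e : s(τ (r, c), τ (r, c + 1)) = rail (ρ r) (-c - 1) := by
      rw [hτ, hτ, ← mk_left, neg_add, sub_eq_add_neg]
    rw [e]
    refine ⟨hrail r c (by omega) (by omega) hc hpw hU, ?_⟩
    by_cases hcj : c + 1 < -j
    · exact Or.inl ⟨hcj, hqw⟩
    · obtain rfl : c = -j - 1 := by omega
      obtain ⟨h3, h4⟩ := hexit r (by omega) hpw hU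
      right
      intro z hz hne
      rw [show -j - 1 + 1 = -j by ring] at hz ⊢
      rw [show -(-j - 1) - 1 = j by ring]
      rcases ladder_adj_cases hz with ⟨rfl, -, h5⟩ | ⟨rfl, -, h5⟩ | ⟨rfl, h5⟩ <;> rw [h5]
      · exact h4
      · exact absurd rfl hne
      · exact Or.inl h3
  · have e : s(τ (r, c), τ (r, c - 1)) = rail (ρ r) (-(c - 1) - 1) := by
      rw [hτ, hτ, show -(c - 1) - 1 = -c by ring, ← mk_right, neg_sub', sub_neg_eq_add]
    rw [e]
    exact ⟨hrail r (c - 1) (by omega) (by omega) (by omega) hqw hU, Or.inl ⟨by dsimp; omega, hqw⟩⟩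
  · have e : s(τ (r, c), τ (1 - r, c)) = rung (-c) := by
      rw [hτ, hτ] at hτadj ⊢
      exact mk_rung hτadj
    rw [e]
    exact ⟨hrung c (by omega) hc hU, Or.inl ⟨hc, hqw⟩⟩

/-! ### Walking around the right half -/

/-- A vertex of the ladder has at most three neighbours. -/
theorem eq_of_ladder_adj_of_ne {p q₁ q₂ q₃ q₄ : ℤ × ℤ} (h₁ : (ladder k).Adj p q₁)
    (h₂ : (ladder k).Adj p q₂) (h₃ : (ladder k).Adj p q₃) (h₄ : (ladder k).Adj p q₄)
    (h₁₂ : q₁ ≠ q₂) (h₃₁ : q₃ ≠ q₁) (h₃₂ : q₃ ≠ q₂) (h₄₁ : q₄ ≠ q₁) (h₄₂ : q₄ ≠ q₂) : q₃ = q₄ := by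
  have h₁ := eq_of_ladder_adj h₁
  have h₂ := eq_of_ladder_adj h₂
  have h₃ := eq_of_ladder_adj h₃
  have h₄ := eq_of_ladder_adj h₄
  grind

/-- The vertex reached after `t` steps of the walk from `(0, 0)` around the right half of the ladder
to `(1, 0)`. -/
def around (k t : ℤ) : ℤ × ℤ := if t ≤ k then (0, t) else (1, 2 * k + 1 - t)

/-- Player 2 is confined to the left half of the ladder, and Player 1 walks around the right half.
Here `F` contains the vertices on the left that Player 2 can still pass through: a move to another
vertex is the last one, so Player 2 has at most `F.card + 1` moves. -/
theorem Safe.of_around (F : Finset (ℤ × ℤ)) {U : Set (Sym2 (ℤ × ℤ))} {t : ℤ} {b : ℤ × ℤ}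
    (ht : 0 ≤ t)
    (hfree : ∀ i, t ≤ i → i ≤ 2 * k → s(around k i, around k (i + 1)) ∉ U)
    (hconf : ∀ p q, p.2 < 0 → (ladder k).Adj p q → s(p, q) ∉ U → q.2 < 0)
    (hb : b.2 < 0) (hbF : b ∉ F) (hprev : ∃ p, (ladder k).Adj b p ∧ s(b, p) ∈ U)
    (hF : ∀ p, p.2 < 0 → p ∉ F → p ≠ b → ∀ q q', (ladder k).Adj p q → (ladder k).Adj p q' →
      s(p, q) ∉ U → s(p, q') ∉ U → q = q')
    (hcard : F.card + t ≤ 2 * k) : Safe (ladder k) U (around k t) b := by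
  refine .of_upto (fun U a b => ∃ (F : Finset (ℤ × ℤ)) (t : ℤ), a = around k t ∧ 0 ≤ t ∧
    (∀ i, t ≤ i → i ≤ 2 * k → s(around k i, around k (i + 1)) ∉ U) ∧
    (∀ p q, p.2 < 0 → (ladder k).Adj p q → s(p, q) ∉ U → q.2 < 0) ∧
    b.2 < 0 ∧ b ∉ F ∧ (∃ p, (ladder k).Adj b p ∧ s(b, p) ∈ U) ∧
    (∀ p, p.2 < 0 → p ∉ F → p ≠ b → ∀ q q', (ladder k).Adj p q → (ladder k).Adj p q' →
      s(p, q) ∉ U → s(p, q') ∉ U → q = q') ∧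
    F.card + t ≤ 2 * k) ?_ ⟨F, t, rfl, ht, hfree, hconf, hb, hbF, hprev, hF, hcard⟩
  clear! F U t b
  rintro U _ b ⟨F, t, rfl, ht, hfree, hconf, hb, hbF, ⟨p₀, hp₀, hp₀U⟩, hF, hcard⟩ q hq hqU
  have hcol : ∀ i, 0 ≤ i → i ≤ 2 * k + 1 → 0 ≤ (around k i).2 := by
    intro i h0 h1
    unfold around
    split_ifs <;> dsimp <;> omega
  have hinj : ∀ i j, around k i = around k j → i = j := by
    intro i j
    unfold around
    split_ifs <;> simp
  have hne : ∀ i, 0 ≤ i → i ≤ 2 * k → s(around k i, around k (i + 1)) ≠ s(b, q) := by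
    intro i h0 h1 heq
    have := hcol i h0 (by omega)
    have := hcol (i + 1) (by omega) (by omega)
    rcases Sym2.eq_iff.1 heq with ⟨h, -⟩ | ⟨-, h⟩ <;> rw [← h] at hb <;> omega
  have hadj : (ladder k).Adj (around k t) (around k (t + 1)) := by
    unfold around
    split_ifs <;> rw [ladder_adj] <;> omega
  refine ⟨around k (t + 1), hadj, ?_, ?_⟩
  · rw [Set.mem_insert_iff, not_or]
    exact ⟨hne t ht (by omega), hfree t le_rfl (by omega)⟩
  by_cases hqF : q ∈ F
  · left
    refine ⟨F.erase q, t + 1, rfl, by omega, fun i h0 h1 => ?_, fun p q' hp hpq hU => ?_,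
      hconf b q hb hq hqU, by simp, ⟨b, hq.symm, ?_⟩, ?_, ?_⟩
    · simp only [Set.mem_insert_iff, not_or]
      refine ⟨fun heq => ?_, hne i (by omega) h1, hfree i (by omega) h1⟩
      rcases Sym2.eq_iff.1 heq with ⟨h, -⟩ | ⟨h, h'⟩
      · have := hinj _ _ h
        omega
      · have := hinj _ _ h
        have := hinj _ _ h'
        omega
    · simp only [Set.mem_insert_iff, not_or] at hU
      exact hconf p q' hp hpq hU.2.2
    · exact Or.inr (Or.inl Sym2.eq_swap)
    · intro p hp hpF hpq q₁ q₂ h1 h2 hU1 hU2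
      simp only [Set.mem_insert_iff, not_or] at hU1 hU2
      by_cases hpb : p = b
      · -- two of the at most three edges at the vertex that Player 2 leaves are used
        subst hpb
        refine eq_of_ladder_adj_of_ne hp₀ hq h1 h2 ?_ ?_ ?_ ?_ ?_
        · rintro rfl
          exact hqU hp₀U
        · rintro rfl
          exact hU1.2.2 hp₀U
        · rintro rfl
          exact hU1.2.1 rfl
        · rintro rfl
          exact hU2.2.2 hp₀U
        · rintro rfl
          exact hU2.2.1 rfl
      · refine hF p hp (fun h => hpF ?_) hpb q₁ q₂ h1 h2 hU1.2.2 hU2.2.2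
        exact Finset.mem_erase.2 ⟨hpq, h⟩
    · have := Finset.card_erase_add_one hqF
      omega
  · right
    refine .of_stuck fun z hz => ?_
    by_contra hzU
    simp only [Set.mem_insert_iff, not_or] at hzU
    refine hzU.2.1 ?_
    rw [Sym2.eq_swap] at hqU
    rw [hF q (hconf b q hb hq (by rwa [Sym2.eq_swap])) hqF hq.ne' z b hz hq.symm hzU.2.2 hqU,
      Sym2.eq_swap]

/-! ### Races -/

section Play

variable {U : Set (Sym2 (ℤ × ℤ))}

attribute [local grind =] rail_inj rung_inj
attribute [local grind .] rail_ne_rung rung_ne_rail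

/-- Player 2 runs back to the centre along row `1`, with all vertices of row `0` on its way in
columns `≤ -2` used up, and Player 1 runs back to the centre along row `0`. Player 1 is in time to
take the last edge at `(0, 0)`. -/
theorem Safe.of_return {i : ℤ} (hi : 1 ≤ i) (hik : i + 1 ≤ k)
    (h₁ : rung 0 ∈ U) (h₂ : rail 1 0 ∈ U) (h₃ : ∀ c, 0 ≤ c → c ≤ i → rail 0 c ∉ U)
    (h₄ : rail 1 (-i - 1) ∈ U)
    (h₅ : ∀ c, 2 ≤ c → c ≤ i → rung (-c) ∈ U ∨ rail 0 (-c - 1) ∈ U ∧ rail 0 (-c) ∈ U)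
    (h₆ : rung (-2) ∈ U) (h₇ : rail 0 (-3) ∈ U) :
    Safe (ladder k) U (0, i + 1) (1, -i) := by
  induction i, hi using Int.leInduction generalizing U with
  | base =>
    refine .of_moves (fun _ _ => ?_) (fun _ _ => ?_) fun _ => ?_
    · refine .left (by omega) (by omega) (by omega) (by grind) (.of_used ?_ ?_ ?_) <;> grind
    · grind
    · refine .left (by omega) (by omega) (by omega) (by grind) (.of_moves ?_ ?_ ?_)
      · intro _ _
        refine .left (by omega) (by omega) (by omega) (by grind) (.of_used ?_ ?_ ?_) <;> grind
      · intro _ _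
        refine .left (by omega) (by omega) (by omega) (by grind) (.of_used ?_ ?_ ?_) <;> grind
      · grind
  | succ i hi ih =>
    refine .of_moves (fun _ _ => ?_) (fun _ _ => ?_) fun _ => ?_
    · refine .left (by omega) (by omega) (by omega) (by grind) ?_
      rw [show -(i + 1) + 1 = -i by ring, show i + 1 + 1 - 1 = i + 1 by ring]
      apply ih <;> grind
    · grind
    · have := h₅ (i + 1) (by omega) le_rfl
      refine .left (by omega) (by omega) (by omega) (by grind) (.of_used ?_ ?_ ?_) <;> grind

/-- Both players run to the right, Player 1 along row `1` and one column ahead of Player 2, who runs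
along row `0`. Player 1 is the first to take the last rung. -/
theorem Safe.of_chase {j : ℤ} (hj : 1 ≤ j) (hjk : j + 1 ≤ k) (h₁ : rail 0 (j - 1) ∈ U)
    (h₂ : rail 1 (j - 1) ∈ U) (h₃ : rail 1 j ∈ U) (h₄ : ∀ c, j < c → rung c ∉ U)
    (h₅ : ∀ c, j < c → rail 1 c ∉ U) : Safe (ladder k) U (1, j + 1) (0, j) := by
  obtain ⟨n, hn⟩ := Int.le.dest hjk
  induction n generalizing U j with
  | zero =>
    refine .of_moves (fun _ _ => ?_) (fun _ _ => ?_) fun _ => ?_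
    · refine .cross (by omega) (by omega) (by omega) (by grind) (.of_used ?_ ?_ ?_) <;> grind
    · grind
    · refine .cross (by omega) (by omega) (by omega) (by grind) (.of_used ?_ ?_ ?_) <;> grind
  | succ n ih =>
    refine .of_moves (fun _ _ => ?_) (fun _ _ => ?_) fun _ => ?_
    · refine .right (by omega) (by omega) (by omega) (by grind) ?_
      apply ih <;> grind
    · grind
    · refine .cross (by omega) (by omega) (by omega) (by grind) (.of_used ?_ ?_ ?_) <;> grind

/-- Player 2 has just left row `0` in column `-j`. If it turns back to the centre, then so does
Player 1, and Player 1 wins the race back. If it goes on to the left, then Player 1 mirrors it. -/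
theorem Safe.of_turn {j : ℤ} (hj : 2 ≤ j) (hjk : j ≤ k)
    (h₁ : rung 0 ∈ U) (h₂ : rail 1 0 ∈ U) (h₃ : ∀ c, 0 ≤ c → rail 0 c ∉ U)
    (h₄ : ∀ c, j ≤ c → rail 1 c ∉ U) (h₄' : ∀ c, j ≤ c → rung c ∉ U)
    (h₅ : ∀ c, 2 ≤ c → c ≤ j - 1 → rung (-c) ∈ U ∨ rail 0 (-c - 1) ∈ U ∧ rail 0 (-c) ∈ U)
    (h₆ : rung (-2) ∈ U) (h₇ : rail 0 (-3) ∈ U) (h₈ : rung (-j) ∈ U)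
    (h₉ : rail 0 (-j) ∈ U ∨ rail 0 (-j - 1) ∈ U) : Safe (ladder k) U (1, j) (1, -j) := by
  refine .of_moves (fun _ _ => ?_) (fun _ _ => ?_) fun _ => ?_
  · refine .cross (by omega) (by omega) (by omega) (by grind) ?_
    have key : Safe (ladder k) (insert (rung j) (insert (rail 1 (-j)) U)) (0, j - 1 + 1)
        (1, -(j - 1)) := by
      apply Safe.of_return <;> grind
    rwa [sub_add_cancel, neg_sub', sub_neg_eq_add] at key
  · refine .right (by omega) (by omega) (by omega) (by grind) ?_
    refine .of_mirror_columns (reflection_apply k) (j := j) (by omega) (0, 1) ?_ (by omega)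
      (by simp) ?_ ?_ ?_ ?_
    · simp; ring
    · rintro ⟨r, c⟩ hc hadj
      rw [ladder_adj] at hadj
      dsimp at hc
      omega
    · intro r c hr _ _ _ _
      obtain rfl | rfl : r = 0 ∨ r = 1 := by omega
      · grind
      · grind
    · grind
    · intro r hr _ h
      obtain rfl | rfl : r = 0 ∨ r = 1 := by omega
      · grind
      · grind
  · grind

/-- Player 2 runs to the left along row `0`, and Player 1 runs to the right along row `1`. -/
theorem Safe.of_run {j : ℤ} (hj : 3 ≤ j) (hjk : j ≤ k)
    (h₁ : rung 0 ∈ U) (h₂ : rail 1 0 ∈ U) (h₃ : ∀ c, 0 ≤ c → rail 0 c ∉ U)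
    (h₄ : ∀ c, j - 1 ≤ c → rail 1 c ∉ U) (h₄' : ∀ c, 1 ≤ c → rung c ∉ U)
    (h₅ : ∀ c, 3 ≤ c → c ≤ j → rail 0 (-c) ∈ U) (h₆ : rung (-2) ∈ U) :
    Safe (ladder k) U (1, j - 1) (0, -j) := by
  obtain ⟨n, hn⟩ := Int.le.dest hjk
  have hj' := h₅ j hj le_rfl
  have h₇ := h₅ 3 le_rfl hj
  induction n generalizing U j with
  | zero =>
    refine .of_moves (fun _ _ => ?_) (fun _ _ => ?_) fun _ => ?_
    · grind
    · omega
    · refine .right (by omega) (by omega) (by omega) (by grind) ?_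
      rw [sub_add_cancel, sub_zero]
      apply Safe.of_turn <;> try grind
      intro c h2 hc
      have := h₅ (c + 1) (by omega) (by omega)
      by_cases hc2 : c = 2
      · grind
      · have := h₅ c (by omega) (by omega)
        grind
  | succ n ih =>
    refine .of_moves (fun _ _ => ?_) (fun _ _ => ?_) fun _ => ?_
    · grind
    · refine .right (by omega) (by omega) (by omega) (by grind) ?_
      rw [show j - 1 + 1 = j + 1 - 1 by ring, show -j - 1 = -(j + 1) by ring]
      apply ih <;> grind
    · refine .right (by omega) (by omega) (by omega) (by grind) ?_
      rw [sub_add_cancel, sub_zero]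
      apply Safe.of_turn <;> try grind
      intro c h2 hc
      have := h₅ (c + 1) (by omega) (by omega)
      by_cases hc2 : c = 2
      · grind
      · have := h₅ c (by omega) (by omega)
        grind

/-- Player 2 has come from `(0, -2)` to `(0, -1)`, and Player 1 has come from `(1, 1)` to
`(0, 1)`. -/
theorem Safe.of_inner (hk : 2 ≤ k) (h₁ : rung 0 ∈ U) (h₂ : rail 1 0 ∈ U) (h₃ : rail 0 (-2) ∈ U)
    (h₄ : rung (-2) ∈ U ∨ rail 0 (-3) ∈ U) (h₅ : ∀ c, 0 ≤ c → rail 0 c ∉ U)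
    (h₆ : ∀ c, 1 ≤ c → rail 1 c ∉ U) (h₇ : ∀ c, 2 ≤ c → rung c ∉ U) :
    Safe (ladder k) U (0, 1) (0, -1) := by
  refine .of_moves (fun _ _ => ?_) (fun _ _ => ?_) fun _ => ?_
  · refine .left (by omega) (by omega) (by omega) (by grind) (.of_used ?_ ?_ ?_) <;> grind
  · grind
  · refine .right (by omega) (by omega) (by omega) (by grind) ?_
    refine .of_moves (fun _ _ => ?_) (fun _ _ => ?_) fun _ => ?_
    · refine .cross (by omega) (by omega) (by omega) (by grind) (.of_used ?_ ?_ ?_) <;> grind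
    · refine .cross (by omega) (by omega) (by omega) (by grind) ?_
      refine .of_moves (fun _ _ => ?_) (fun _ _ => ?_) fun _ => ?_
      · grind
      · refine .right (by omega) (by omega) (by omega) (by grind) ?_
        refine .of_mirror_columns (reflection_apply k) (j := 2) (by omega) (0, 1) ?_ (by omega)
          (by simp) ?_ ?_ ?_ ?_
        · norm_num
        · rintro ⟨r, c⟩ hc hadj
          rw [ladder_adj] at hadj
          dsimp at hc
          omega
        · intro r c hr _ _ _ _
          obtain rfl | rfl : r = 0 ∨ r = 1 := by omega
          · grind
          · grind
        · grind
        · intro r hr _ h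
          obtain rfl | rfl : r = 0 ∨ r = 1 := by omega
          · grind
          · grind
      · refine .left (by omega) (by omega) (by omega) (by grind) (.of_used ?_ ?_ ?_) <;> grind
    · grind

/-! ### Cutting off Player 2 -/

/-- Player 2 can no longer leave the left half of the ladder, which has `2 * k` vertices, and
Player 1 is at `(0, 0)` with the right half untouched: walking around it takes `2 * k + 1` moves. -/
theorem Safe.of_confined {b : ℤ × ℤ} (hb : b.2 < 0) (hk : 1 ≤ k)
    (hprev : ∃ p, (ladder k).Adj b p ∧ s(b, p) ∈ U) (h₁ : rail 0 (-1) ∈ U) (h₂ : rail 1 (-1) ∈ U)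
    (h₃ : ∀ c, 0 ≤ c → rail 0 c ∉ U) (h₄ : ∀ c, 0 ≤ c → rail 1 c ∉ U)
    (h₅ : ∀ c, 1 ≤ c → rung c ∉ U) : Safe (ladder k) U (0, 0) b := by
  have hmem : ∀ p q, (ladder k).Adj p q → p.2 < 0 →
      p ∈ Finset.Icc (0 : ℤ) 1 ×ˢ Finset.Icc (-k) (-1) := by
    rintro ⟨r, c⟩ ⟨r', c'⟩ h hc
    rw [ladder_adj] at h
    simp only [Finset.mem_product, Finset.mem_Icc]
    dsimp at hc
    omega
  have hcard : (Finset.Icc (0 : ℤ) 1 ×ˢ Finset.Icc (-k) (-1)).card = 2 * k.toNat := by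
    simp
  have key : Safe (ladder k) U (around k 0) b := by
    refine .of_around ((Finset.Icc (0 : ℤ) 1 ×ˢ Finset.Icc (-k) (-1)).erase b) le_rfl
      (fun i h0 hi => ?_) ?_ hb (by simp) hprev ?_ ?_
    · rcases lt_trichotomy i k with h | rfl | h
      · rw [around, around, if_pos h.le, if_pos (by omega), mk_right]
        exact h₃ i h0
      · rw [around, around, if_pos le_rfl, if_neg (by omega),
          show 2 * i + 1 - (i + 1) = i by ring, ← rung.eq_1]
        exact h₅ i hk
      · rw [around, around, if_neg (by omega), if_neg (by omega),
          show 2 * k + 1 - (i + 1) = 2 * k + 1 - i - 1 by ring, mk_left]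
        exact h₄ _ (by omega)
    · rintro ⟨r, c⟩ q hc hq hU
      dsimp at hc
      have hq' := hq
      rcases ladder_adj_cases hq with ⟨rfl, -, h⟩ | ⟨rfl, -, h⟩ | ⟨rfl, h⟩
      · rw [h] at hU
        rw [ladder_adj] at hq'
        by_contra! hc'
        obtain rfl : c = -1 := by dsimp at hc'; omega
        obtain rfl | rfl : r = 0 ∨ r = 1 := by omega
        · exact hU h₁
        · exact hU h₂
      · dsimp; omega
      · exact hc
    · intro p hp hpF hpb q _ hq
      exact absurd (Finset.mem_erase.2 ⟨hpb, hmem p q hq hp⟩) hpF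
    · obtain ⟨p, hp, -⟩ := hprev
      rw [Finset.card_erase_of_mem (hmem b p hp hb), hcard]
      omega
  rwa [around, if_pos (by omega)] at key

/-- Player 1 is about to cut off Player 2 by the moves to `(0, -1)` and `(0, 0)`, and Player 2 is
too far away to prevent this. -/
theorem Safe.of_cut {r c : ℤ} (hr : 0 ≤ r ∧ r ≤ 1) (hc : c ≤ -2) (hck : -k ≤ c)
    (h₁ : rail 1 (-1) ∈ U) (h₂ : ∀ c, -1 ≤ c → rail 0 c ∉ U)
    (h₃ : ∀ c, 0 ≤ c → rail 1 c ∉ U) (h₄ : rung (-1) ∉ U) (h₅ : ∀ c, 1 ≤ c → rung c ∉ U)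
    (h₆ : r = 0 → c = -2 → rail 0 (-2) ∈ U) : Safe (ladder k) U (1, -1) (r, c) := by
  -- the second of the three moves of Player 1 from `(1, 0)` to `(0, 0)`
  have second : ∀ r' c' : ℤ, ∀ e, 0 ≤ r' ∧ r' ≤ 1 → -k ≤ c' → c' ≤ -1 → ¬(r' = 0 ∧ c' = -1) →
      (∀ c, -1 ≤ c → rail 0 c ≠ e) → (∀ c, 0 ≤ c → rail 1 c ≠ e) → rung (-1) ≠ e →
      (∀ c, 1 ≤ c → rung c ≠ e) →
      CanReply k (insert e U) (1, -1) (r', c') := by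
    intro r' c' e hr' hck' hc' hne e₁ e₂ e₃ e₄
    refine .cross (by omega) (by omega) (by omega) (by grind) ?_
    -- the third move
    have third : ∀ b : ℤ × ℤ, ∀ f, b.2 < 0 → (ladder k).Adj b (r', c') →
        f = s((r', c'), b) → (∀ c, -1 ≤ c → rail 0 c ≠ f) → (∀ c, 0 ≤ c → rail 1 c ≠ f) →
        (∀ c, 1 ≤ c → rung c ≠ f) →
        CanReply k (insert f (insert (rung (-1)) (insert e U))) (0, -1) b := by
      intro b f hb hbadj hf f₁ f₂ f₃
      refine .right (by omega) (by omega) (by omega) (by grind) ?_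
      refine .of_confined hb (by omega) ⟨_, hbadj, ?_⟩ ?_ ?_ ?_ ?_ ?_
      · rw [hf, Sym2.eq_swap]
        simp
      all_goals grind
    refine .of_reply fun q hq hqU => ?_
    have hq' := hq
    rcases ladder_adj_cases hq with ⟨rfl, h1, h2⟩ | ⟨rfl, h1, h2⟩ | ⟨rfl, h2⟩ <;>
      rw [ladder_adj] at hq' <;> rw [h2] at hqU
    · have : c' ≤ -2 := by grind
      refine third _ _ (by dsimp; omega) hq.symm rfl ?_ ?_ ?_ <;> rw [h2] <;> grind
    · refine third _ _ (by dsimp; omega) hq.symm rfl ?_ ?_ ?_ <;> rw [h2] <;> grind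
    · refine third _ _ (by dsimp; omega) hq.symm rfl ?_ ?_ ?_ <;> rw [h2] <;> grind
  refine .of_moves (fun _ _ => ?_) (fun _ _ => ?_) fun _ => ?_
  · apply second <;> grind
  · apply second <;> grind
  · apply second <;> grind

/-! ### The answers to the first move of Player 2 -/

variable {e : Sym2 (ℤ × ℤ)}

/-- Player 2 has moved to `(1, -1)`: Player 1 moves to `(1, 1)` and then reflects. -/
theorem CanReply.of_reflection (hk : 2 ≤ k)
    (he : e = rail 1 (-1) ∨ e = rail 1 (-2) ∨ e = rung (-1)) :
    CanReply k {e, rung 0} (1, 0) (1, -1) := by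
  refine .right (by omega) (by omega) (by omega) (by grind) ?_
  -- Player 2 is stuck once it enters column `0`, because the central rung is used
  have mirror : ∀ (U : Set (Sym2 (ℤ × ℤ))) (w : ℤ × ℤ) (a : ℤ × ℤ) (r c : ℤ), a = (r, -c) →
      c < 0 → (r, c) ≠ w → rung 0 ∈ U →
      (∀ p, p.2 < 0 → (ladder k).Adj p w → s(p, w) ∈ U) →
      (∀ r c, 0 ≤ r ∧ r ≤ 1 → c < 0 → (r, c) ≠ w → rail r c ∉ U → rail r (-c - 1) ∉ U) →
      (∀ c, c < 0 → rung c ∉ U → rung (-c) ∉ U) →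
      Safe (ladder k) U a (r, c) := by
    intro U w a r c ha hc hcw h0 hw h1 h2
    refine .of_mirror_columns (ρ := fun r => r) (j := 0) (reflection_apply k) le_rfl w ha (by omega)
      hcw (by simpa using hw) (fun r c hr _ hc => h1 r c hr (by omega))
      (fun c _ hc => h2 c (by omega)) fun r _ _ _ => ?_
    simpa using h0
  -- in this case the position is fully symmetric, and `w` is an irrelevant vertex on the right
  by_cases he' : e = rail 1 (-1)
  · refine mirror _ (0, 1) _ _ _ (by simp) (by omega) (by simp) (by simp) ?_ ?_ ?_
    · rintro ⟨r, c⟩ hc hadj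
      rw [ladder_adj] at hadj
      dsimp at hc
      omega
    · grind
    · grind
  -- otherwise the edge from the vertex of Player 2 to column `0` has no free mirror image, but
  -- Player 2 can take it only at once: that vertex cannot be entered again from the left half
  have hw : ∀ U : Set (Sym2 (ℤ × ℤ)), rail 1 (-2) ∈ U → rung (-1) ∈ U →
      ∀ p : ℤ × ℤ, p.2 < 0 → (ladder k).Adj p (1, -1) → s(p, (1, -1)) ∈ U := by
    intro U h1 h2 p hp hadj
    rw [Sym2.eq_swap]
    rcases ladder_adj_cases hadj.symm with ⟨rfl, -, h⟩ | ⟨rfl, -, h⟩ | ⟨rfl, h⟩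
    · simp at hp
    · rw [h]
      exact h1
    · rw [h]
      exact h2
  refine .of_moves (fun _ _ => ?_) (fun _ _ => ?_) fun _ => ?_
  · refine .right (by omega) (by omega) (by omega) (by grind) (.of_used ?_ ?_ ?_) <;> grind
  · refine .right (by omega) (by omega) (by omega) (by grind) ?_
    refine mirror _ (1, -1) _ _ _ (by norm_num) (by omega) (by simp) (by simp) (hw _ ?_ ?_) ?_ ?_
      <;> grind
  · refine .cross (by omega) (by omega) (by omega) (by grind) ?_
    refine mirror _ (1, -1) _ _ _ (by norm_num) (by omega) (by simp) (by simp) (hw _ ?_ ?_) ?_ ?_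
      <;> grind

/-- Player 2 has moved to `(0, -1)`: Player 1 moves to `(1, 1)` and then rotates. -/
theorem CanReply.of_rotation (hk : 2 ≤ k)
    (he : e = rail 0 (-1) ∨ e = rail 0 (-2) ∨ e = rung (-1)) :
    CanReply k {e, rung 0} (1, 0) (0, -1) := by
  refine .right (by omega) (by omega) (by omega) (by grind) ?_
  -- Player 2 can enter column `0` only at `(1, 0)`, where it is stuck
  have mirror : ∀ (U : Set (Sym2 (ℤ × ℤ))) (w : ℤ × ℤ) (a : ℤ × ℤ) (r c : ℤ), a = (1 - r, -c) →
      c < 0 → (r, c) ≠ w → rung 0 ∈ U → rail 1 0 ∈ U →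
      (rail 0 (-1) ∈ U ∨ w = (0, -1)) →
      (∀ p, p.2 < 0 → (ladder k).Adj p w → s(p, w) ∈ U) →
      (∀ r c, 0 ≤ r ∧ r ≤ 1 → c < 0 → (r, c) ≠ w → rail r c ∉ U → rail (1 - r) (-c - 1) ∉ U) →
      (∀ c, c < 0 → rung c ∉ U → rung (-c) ∉ U) →
      Safe (ladder k) U a (r, c) := by
    intro U w a r c ha hc hcw h0 h0' h0w hw h1 h2
    refine .of_mirror_columns (ρ := fun r => 1 - r) (j := 0) (rotation_apply k) le_rfl w ha
      (by omega) hcw (by simpa using hw) (fun r c hr _ hc => h1 r c hr (by omega))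
      (fun c _ hc => h2 c (by omega)) fun r hr hrw hrU => ?_
    obtain rfl | rfl : r = 0 ∨ r = 1 := by omega
    · rcases h0w with h | rfl
      · exact absurd h (by simpa using hrU)
      · simp at hrw
    · exact ⟨by simpa using h0, Or.inl (by simpa using h0')⟩
  -- in this case the position is fully symmetric, and `w` is an irrelevant vertex on the right
  by_cases he' : e = rail 0 (-1)
  · refine mirror _ (0, 1) _ _ _ (by simp) (by omega) (by simp) (by simp) (by simp)
      (by simp [he']) ?_ ?_ ?_
    · rintro ⟨r, c⟩ hc hadj
      rw [ladder_adj] at hadj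
      dsimp at hc
      omega
    · grind
    · grind
  -- otherwise the edge from the vertex of Player 2 to column `0` has no free mirror image, but
  -- Player 2 can take it only at once: that vertex cannot be entered again from the left half
  have hw : ∀ U : Set (Sym2 (ℤ × ℤ)), rail 0 (-2) ∈ U → rung (-1) ∈ U →
      ∀ p : ℤ × ℤ, p.2 < 0 → (ladder k).Adj p (0, -1) → s(p, (0, -1)) ∈ U := by
    intro U h1 h2 p hp hadj
    rw [Sym2.eq_swap]
    rcases ladder_adj_cases hadj.symm with ⟨rfl, -, h⟩ | ⟨rfl, -, h⟩ | ⟨rfl, h⟩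
    · simp at hp
    · rw [h]
      exact h1
    · rw [h]
      exact h2
  refine .of_moves (fun _ _ => ?_) (fun _ _ => ?_) fun _ => ?_
  · refine .cross (by omega) (by omega) (by omega) (by grind) ?_
    refine .of_moves (fun _ _ => ?_) (fun _ _ => ?_) fun _ => ?_
    · refine .right (by omega) (by omega) (by omega) (by grind) (.of_used ?_ ?_ ?_) <;> grind
    · grind
    · grind
  · refine .right (by omega) (by omega) (by omega) (by grind) ?_
    refine mirror _ (0, -1) _ _ _ (by norm_num) (by omega) (by simp) (by simp) (by simp) (by simp)
      (hw _ ?_ ?_) ?_ ?_ <;> grind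
  · refine .cross (by omega) (by omega) (by omega) (by grind) ?_
    refine mirror _ (0, -1) _ _ _ (by norm_num) (by omega) (by simp) (by simp) (by simp) (by simp)
      (hw _ ?_ ?_) ?_ ?_ <;> grind

/-- Player 2 has moved from `(0, -1)` to `(0, 0)`. -/
theorem CanReply.of_centre (hk : 2 ≤ k) :
    CanReply k {rail 0 (-1), rung 0} (1, 0) (0, 0) := by
  refine .right (by omega) (by omega) (by omega) (by grind) ?_
  refine .of_moves (fun _ _ => ?_) (fun _ _ => ?_) fun _ => ?_
  · refine .right (by omega) (by omega) (by omega) (by grind) ?_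
    apply Safe.of_chase (j := 0 + 1) <;> grind
  · grind
  · grind

/-- Player 2 has moved to `(0, -2)`, but not from `(0, -1)`. -/
theorem CanReply.of_run (hk : 2 ≤ k) (he : e = rail 0 (-3) ∧ 3 ≤ k ∨ e = rung (-2)) :
    CanReply k {e, rung 0} (1, 0) (0, -2) := by
  refine .right (by omega) (by omega) (by omega) (by grind) ?_
  refine .of_moves (fun _ _ => ?_) (fun _ _ => ?_) fun _ => ?_
  · refine .cross (by omega) (by omega) (by omega) (by grind) ?_
    apply Safe.of_inner <;> grind
  · refine .right (by omega) (by omega) (by omega) (by grind) ?_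
    refine Safe.of_run (j := 3) le_rfl (by omega) ?_ ?_ ?_ ?_ ?_ ?_ ?_ <;> grind
  · refine .right (by omega) (by omega) (by omega) (by grind) ?_
    refine Safe.of_turn (j := 2) le_rfl (by omega) ?_ ?_ ?_ ?_ ?_ ?_ ?_ ?_ ?_ ?_ <;> grind

/-- Player 1, who has opened with the central rung, can answer each first move of Player 2 in the
left half of the ladder. -/
theorem canReply_of_left (hk : 2 ≤ k) {b₀ b : ℤ × ℤ} (hadj : (ladder k).Adj b₀ b)
    (hb₀ : b₀.2 ≤ 0) (hb : b.2 ≤ 0) (hne : s(b₀, b) ≠ rung 0) :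
    CanReply k {s(b₀, b), rung 0} (1, 0) b := by
  obtain ⟨r, c⟩ := b
  have hadj' := hadj
  obtain ⟨r', c'⟩ := b₀
  rw [ladder_adj] at hadj'
  dsimp only at hb hb₀
  rw [Sym2.eq_swap] at hne ⊢
  obtain ⟨e, he⟩ : ∃ e, e = s((r, c), (r', c')) := ⟨_, rfl⟩
  rw [← he] at hne ⊢
  have hcases : e = rail r c ∧ c < 0 ∨ e = rail r (c - 1) ∧ -k < c ∨ e = rung c ∧ c < 0 := by
    rw [he] at hne ⊢
    rcases ladder_adj_cases hadj.symm with ⟨h1, -, h2⟩ | ⟨h1, h3, h2⟩ | ⟨h1, h2⟩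
    · rw [Prod.mk.injEq] at h1
      exact Or.inl ⟨h2, by omega⟩
    · exact Or.inr (Or.inl ⟨h2, h3⟩)
    · rw [h2, ne_eq, rung_inj] at hne
      exact Or.inr (Or.inr ⟨h2, by omega⟩)
  clear he hadj
  have hr : r = 0 ∨ r = 1 := by omega
  obtain rfl | rfl | hc : c = 0 ∨ c = -1 ∨ c ≤ -2 := by omega
  · rcases hr with rfl | rfl
    · obtain rfl : e = rail 0 (-1) := by grind
      exact .of_centre hk
    · obtain rfl : e = rail 1 (-1) := by grind
      refine .right (by omega) (by omega) (by omega) (by grind) (.of_used ?_ ?_ ?_) <;> grind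
  · rcases hr with rfl | rfl
    · exact .of_rotation hk (by grind)
    · exact .of_reflection hk (by grind)
  by_cases h2 : r = 0 ∧ c = -2 ∧ e ≠ rail 0 (-2)
  · obtain ⟨rfl, rfl, he⟩ := h2
    exact .of_run hk (by grind)
  · refine .left (by omega) (by omega) (by omega) (by grind) ?_
    apply Safe.of_cut <;> grind

end Play

/-! ### The ladder as a Cartesian product -/

/-- The ladder with `2 * k + 1` columns, as a copy inside the ladder in centred coordinates. -/
def ladderEmbedding (k : ℕ) :
    (SimpleGraph.pathGraph 2 □ SimpleGraph.pathGraph (2 * k + 1)) ↪g ladder k where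
  toFun p := ((p.1 : ℕ), (p.2 : ℕ) - (k : ℤ))
  inj' p q h := by
    rw [Prod.mk.injEq] at h
    ext <;> omega
  map_rel_iff' := by
    rintro ⟨r, c⟩ ⟨r', c'⟩
    change (ladder k).Adj ((r : ℕ), (c : ℕ) - (k : ℤ)) ((r' : ℕ), (c' : ℕ) - (k : ℤ)) ↔ _
    simp only [ladder_adj, SimpleGraph.boxProd_adj, SimpleGraph.pathGraph_adj, Fin.ext_iff]
    omega

theorem p1Win_ladder (k : ℕ) (hk : 2 ≤ k) :
    P1Win (SimpleGraph.pathGraph 2 □ SimpleGraph.pathGraph (2 * k + 1)) := by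
  have hrung : s(((0 : ℤ), (0 : ℤ)), ((1 : ℤ), (0 : ℤ))) = rung 0 := by rw [rung]
  refine p1Win_of_safe (ladderEmbedding k) ?_ (a₀ := (0, 0)) (a := (1, 0)) ?_ ?_
  · rintro ⟨r, c⟩ ⟨r', c'⟩ h
    rw [ladder_adj] at h
    refine ⟨(⟨r.toNat, by omega⟩, ⟨(c + k).toNat, by omega⟩), ?_⟩
    change (((r.toNat : ℕ) : ℤ), (((c + k).toNat : ℕ) : ℤ) - (k : ℤ)) = (r, c)
    rw [Prod.mk.injEq]
    omega
  · rw [ladder_adj]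
    omega
  · intro b₀ b hadj hne
    rw [hrung] at hne ⊢
    by_cases hleft : b₀.2 ≤ 0 ∧ b.2 ≤ 0
    · exact canReply_of_left (by omega) hadj hleft.1 hleft.2 hne
    · -- the reflection takes the first move of Player 2 to the left half
      let φ := reflection (k : ℤ)
      have hφφ : ∀ p, φ (φ p) = p := fun p => Prod.ext rfl (neg_neg _)
      have hmap : ∀ e, Sym2.map φ (Sym2.map φ e) = e := fun e => by
        induction e with | _ p q => rw [Sym2.map_mk, Sym2.map_mk, hφφ, hφφ]
      have hφ0 : Sym2.map φ (rung 0) = rung 0 := by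
        rw [← hrung]
        rfl
      have hne' : s(φ b₀, φ b) ≠ rung 0 := fun h => hne (by
        rw [← hmap s(b₀, b), Sym2.map_mk, h, hφ0])
      have hadj' := hadj
      obtain ⟨-, -, h⟩ := hadj'
      have h1 : (φ b₀).2 = -b₀.2 := rfl
      have h2 : (φ b).2 = -b.2 := rfl
      obtain ⟨a, h3, h4, h5⟩ := canReply_of_left (by omega) (φ.map_adj_iff.2 hadj) (by omega)
        (by omega) hne'
      have hset : Sym2.map φ '' {s(φ b₀, φ b), rung 0} = {s(b₀, b), rung 0} := by
        rw [Set.image_pair, hφ0, Sym2.map_mk, hφφ, hφφ]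
      have hedge : s((1, 0), φ a) = Sym2.map φ s((1, 0), a) := rfl
      refine ⟨φ a, φ.map_adj_iff.2 h3, ?_, ?_⟩
      · rw [hedge, ← hset, (Sym2.map.injective φ.injective).mem_set_image]
        exact h4
      · have := h5.map φ
        rwa [Set.image_insert_eq, hset, hφφ, ← hedge] at this

end TrailTrap

theorem mainTheorem4 (n : ℕ) (hn : 3 < n) (hodd : Odd n) :
    TrailTrap.P1Win (SimpleGraph.pathGraph 2 □ SimpleGraph.pathGraph n) := by
  obtain ⟨k, rfl⟩ := hodd
  exact TrailTrap.p1Win_ladder k (by omega)
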